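/- Let $N,n,d\ge 0$ be integers. Let $\mathcal L$ be a smooth horizontal $d$-form on the $n$-th jet bundle of functions $u:\mathbb R^N\to\mathbb R$, that is, a $d$-form on $\mathbb R^N$ whose coefficients are smooth functions of $t\in\mathbb R^N$ and of the jet coordinates $u_I$, $|I|\le n$. For $u\in C^\infty(\mathbb R^N)$ and a horizontal form $\omega$, write $\omega[u]$ for the form on $\mathbb R^N$ obtained by inserting the partial derivatives of $u$ at $t$ for the coordinates $u_I$. Let $\mathrm D_j=\partial_{t_j}+\sum_I u_{Ij}\,\partial_{u_I}$ be the total derivatives, $\mathrm d\omega=\sum_j \mathrm dt_j\wedge \mathrm D_j\omega$ the horizontal exterior derivative (so $\mathrm d\mathcal L$ is a horizontal $(d+1)$-form on the $(n+1)$-st jet bundle), and $\delta\omega=\sum_I \partial_{u_I}\omega\;\delta u_I$ the vertical exterior derivative. A field $u\in C^\infty(\mathbb R^N)$ is called a critical point (a solution of the pluri-Lagrangian problem for $\mathcal L$) if for every compact oriented smoothly embedded $d$-dimensional surface $S\subset\mathbb R^N$, with or without boundary, and every $V\in C^\infty(\mathbb R^N)$ that vanishes near $\partial S$, $$\int_S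 \iota_{\mathrm{pr}V}\,\delta\mathcal L=0,\qquad\text{where}\quad \iota_{\mathrm{pr}V}\,\delta\mathcal L=\sum_{|I|\le n} V_I\,(\partial_{u_I}\mathcal L)[u]$$ and $V_I$ denotes the partial derivative of $V$ with multi-index $I$. The set of critical points carries the topology of $C^\infty(\mathbb R^N)$, that is, of locally uniform convergence of all partial derivatives. Then: (1) for every critical point $u$, $\delta(\mathrm d\mathcal L)=0$ at the $(n+1)$-jet of $u$ at every point $t\in\mathbb R^N$; (2) $\mathrm d\mathcal L$ is constant on every connected set $C$ of critical points: there is a $(d+1)$-form $\eta$ on $\mathbb R^N$ such that $(\mathrm d\mathcal L)[u]=\eta$ for all $u\in C$. If moreover $\mathcal L$ is autonomous (its coefficients do not depend explicitly on $t$), then $\eta$ has constant coefficients. In particular, if the space of critical points is connected, then $\mathrm d\mathcal L$ is constant on it. -/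

import Mathlib

open scoped ContDiff Topology

noncomputable section

namespace PluriLagrangian

/-- Multi-time `ℝ^N`, with coordinates `t_1, …, t_N`. -/
abbrev MultiTime (N : ℕ) : Type := EuclideanSpace ℝ (Fin N)

/-! ### Fields and their partial derivatives -/

/-- The partial derivative `∂f / ∂t_i`. -/
def pd {N : ℕ} (i : Fin N) (f : MultiTime N → ℝ) : MultiTime N → ℝ :=
  fun t => fderiv ℝ f t (EuclideanSpace.single i 1)

/-- The iterated partial derivative `f_I = ∂_1^{i_1} ⋯ ∂_N^{i_N} f`, for `I = (i_1, …, i_N)`. -/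
def mpd {N : ℕ} (I : Fin N → ℕ) (f : MultiTime N → ℝ) : MultiTime N → ℝ :=
  (List.finRange N).foldr (fun i g => (pd i)^[I i] g) f

/-- A field: a smooth function on multi-time. -/
structure SmoothField (N : ℕ) where
  toFun : MultiTime N → ℝ
  smooth : ContDiff ℝ ∞ toFun

lemma contDiff_pd {N : ℕ} (i : Fin N) {f : MultiTime N → ℝ} (hf : ContDiff ℝ ∞ f) :
    ContDiff ℝ ∞ (pd i f) :=
  (hf.fderiv_right (m := ∞) (by simp)).clm_apply contDiff_const

lemma contDiff_mpd {N : ℕ} (I : Fin N → ℕ) {f : MultiTime N → ℝ} (hf : ContDiff ℝ ∞ f) :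
    ContDiff ℝ ∞ (mpd I f) := by
  have hiter : ∀ (i : Fin N) (k : ℕ) (g : MultiTime N → ℝ), ContDiff ℝ ∞ g →
      ContDiff ℝ ∞ ((pd i)^[k] g) := by
    intro i k
    induction k with
    | zero => intro g hg; simpa using hg
    | succ k ih => intro g hg; rw [Function.iterate_succ_apply]; exact ih _ (contDiff_pd i hg)
  unfold mpd
  induction List.finRange N with
  | nil => simpa using hf
  | cons i l ih => exact hiter i (I i) _ ih

/-- The partial derivative `u_I` of a field as a continuous function. -/
def SmoothField.derivMap {N : ℕ} (u : SmoothField N) (I : Fin N → ℕ) : C(MultiTime N, ℝ) :=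
  ⟨mpd I u.toFun, (contDiff_mpd I u.smooth).continuous⟩

/-- The usual topology of `C^∞(ℝ^N)`: uniform convergence on compact sets of all partial
derivatives (`C(ℝ^N, ℝ)` carries the compact-open topology). -/
instance (N : ℕ) : TopologicalSpace (SmoothField N) :=
  TopologicalSpace.induced
    (fun (u : SmoothField N) (I : Fin N → ℕ) => u.derivMap I) inferInstance

/-! ### Jets and horizontal forms -/

/-- Multi-indices `I` with `|I| ≤ n`. -/
abbrev MultiIndex (N n : ℕ) : Type := {I : Fin N → ℕ // ∑ i, I i ≤ n}

instance (N n : ℕ) : Finite (MultiIndex N n) :=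
  Set.Finite.to_subtype <| (Set.finite_Iic (fun _ : Fin N => n)).subset fun I hI i =>
    (Finset.single_le_sum (f := I) (fun _ _ => Nat.zero_le _) (Finset.mem_univ i)).trans hI

instance (N n : ℕ) : Fintype (MultiIndex N n) := Fintype.ofFinite _

/-- The multi-index `I`, regarded as a multi-index of order at most `n + 1`. -/
def MultiIndex.weaken {N n : ℕ} (I : MultiIndex N n) : MultiIndex N (n + 1) :=
  ⟨I.1, I.2.trans (Nat.le_succ n)⟩

/-- The multi-index `Ij`, in which the `j`-th entry is increased by one. -/
def MultiIndex.shift {N n : ℕ} (I : MultiIndex N n) (j : Fin N) : MultiIndex N (n + 1) :=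
  ⟨I.1 + Pi.single j 1, by
    have h : ∑ i, (I.1 + Pi.single j 1 : Fin N → ℕ) i = ∑ i, I.1 i + 1 := by
      simp [Finset.sum_add_distrib]
    rw [h]
    exact Nat.succ_le_succ I.2⟩

/-- The fibre of the `n`-th jet bundle, with coordinates `u_I`, `|I| ≤ n`. -/
abbrev Jet (N n : ℕ) : Type := MultiIndex N n → ℝ

/-- The `n`-jet of a function at the point `t`. -/
def jet {N : ℕ} (n : ℕ) (f : MultiTime N → ℝ) (t : MultiTime N) : Jet N n :=
  fun I => mpd I.1 f t

/-- Horizontal `q`-forms (forms of type `(0, q)`) on the `n`-th jet bundle: `q`-forms on `ℝ^N`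
whose coefficients depend on `t` and on the jet coordinates `u_I`, `|I| ≤ n`. -/
abbrev HorizontalForm (N n q : ℕ) : Type :=
  MultiTime N × Jet N n → MultiTime N [⋀^Fin q]→L[ℝ] ℝ

/-- The linear map `v ↦ (v, (∑ j, v_j u_{Ij})_I)`, through which the total derivatives act:
`D_j f = ∂f/∂t_j + ∑_I u_{Ij} ∂f/∂u_I`. -/
def totalLift {N n : ℕ} (p : Jet N (n + 1)) : MultiTime N →L[ℝ] MultiTime N × Jet N n :=
  (ContinuousLinearMap.id ℝ (MultiTime N)).prod
    (ContinuousLinearMap.pi fun I : MultiIndex N n =>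
      ∑ j, p (I.shift j) • (EuclideanSpace.proj j : MultiTime N →L[ℝ] ℝ))

/-- The horizontal exterior derivative `d η = ∑_j dt_j ∧ D_j η` of a horizontal form. -/
def horizontalD {N n q : ℕ} (η : HorizontalForm N n q) : HorizontalForm N (n + 1) (q + 1) :=
  fun x => ContinuousAlternatingMap.alternatizeUncurryFin
    ((fderiv ℝ η (x.1, fun I => x.2 I.weaken)).comp (totalLift x.2))

/-- The vertical exterior derivative `δ η = ∑_I ∂η/∂u_I δu_I` of a horizontal form, at a point of
the jet bundle. The contraction with the vertical vector `∑_I a_I ∂/∂u_I` is evaluation at `a`. -/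
def verticalD {N n q : ℕ} (η : HorizontalForm N n q) (x : MultiTime N × Jet N n) :
    Jet N n →L[ℝ] (MultiTime N [⋀^Fin q]→L[ℝ] ℝ) :=
  fderiv ℝ (fun p : Jet N n => η (x.1, p)) x.2

/-- The form `η[u]` on `ℝ^N`, obtained by evaluating a horizontal form on the field `u`. -/
def HorizontalForm.eval {N n q : ℕ} (η : HorizontalForm N n q) (u : SmoothField N) :
    MultiTime N → MultiTime N [⋀^Fin q]→L[ℝ] ℝ :=
  fun t => η (t, jet n u.toFun t)

/-- A horizontal form is autonomous if its coefficients do not depend explicitly on `t`. -/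
def HorizontalForm.Autonomous {N n q : ℕ} (η : HorizontalForm N n q) : Prop :=
  ∀ (s t : MultiTime N) (p : Jet N n), η (s, p) = η (t, p)

/-! ### Surfaces and integration -/

/-- A smooth embedded parametrized patch of dimension `d` in `ℝ^N`. -/
structure Patch (N d : ℕ) where
  source : Set (EuclideanSpace ℝ (Fin d))
  toFun : EuclideanSpace ℝ (Fin d) → MultiTime N
  isOpen_source : IsOpen source
  contDiffOn : ContDiffOn ℝ ∞ toFun source
  immersion : ∀ x ∈ source, Function.Injective (fderiv ℝ toFun x)
  embedding : Topology.IsEmbedding (source.domRestrict toFun)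

/-- The integral over the patch of the pull-back of a `d`-form. -/
def Patch.integral {N d : ℕ} (φ : Patch N d) (α : MultiTime N → MultiTime N [⋀^Fin d]→L[ℝ] ℝ) :
    ℝ :=
  ∫ x in φ.source,
    α (φ.toFun x) (fun i => fderiv ℝ φ.toFun x (EuclideanSpace.single i (1 : ℝ)))

/-- A compact oriented `d`-dimensional surface in `ℝ^N`: a compact set `carrier` with a closed
subset `boundary` (possibly empty), such that `carrier \ boundary` is a smooth embedded
`d`-dimensional submanifold, oriented by an atlas of patches. Variations will vanish near the
boundary, so that no regularity of the boundary is needed. -/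
structure OrientedSurface (N d : ℕ) where
  carrier : Set (MultiTime N)
  boundary : Set (MultiTime N)
  atlas : Set (Patch N d)
  isCompact_carrier : IsCompact carrier
  isClosed_boundary : IsClosed boundary
  boundary_subset : boundary ⊆ carrier
  image_isOpen : ∀ φ ∈ atlas, ∃ W : Set (MultiTime N), IsOpen W ∧
    φ.toFun '' φ.source = W ∩ (carrier \ boundary)
  cover : ∀ y ∈ carrier \ boundary, ∃ φ ∈ atlas, y ∈ φ.toFun '' φ.source
  oriented : ∀ φ ∈ atlas, ∀ ψ ∈ atlas, ∀ x ∈ φ.source, ∀ y ∈ ψ.source, φ.toFun x = ψ.toFun y →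
    ∃ A : EuclideanSpace ℝ (Fin d) →L[ℝ] EuclideanSpace ℝ (Fin d),
      0 < A.det ∧ fderiv ℝ ψ.toFun y = (fderiv ℝ φ.toFun x).comp A

/-- `S.HasIntegral α c` means that `∫_S α = c`, for a `d`-form `α` that vanishes near the boundary
of `S`: the integral is computed with finitely many patches `φ k` of the surface and smooth
functions `χ k` with sum one where `α` does not vanish on `S`, such that the restriction of
`χ k • α` to `S` vanishes outside a compact subset of the patch `φ k`. -/
def OrientedSurface.HasIntegral {N d : ℕ} (S : OrientedSurface N d)
    (α : MultiTime N → MultiTime N [⋀^Fin d]→L[ℝ] ℝ) (c : ℝ) : Prop :=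
  ∃ (m : ℕ) (φ : Fin m → Patch N d) (χ : Fin m → MultiTime N → ℝ),
    (∀ k, φ k ∈ S.atlas) ∧
    (∀ k, ContDiff ℝ ∞ (χ k)) ∧
    (∀ k, ∃ K ⊆ (φ k).source, IsCompact K ∧
      ∀ y ∈ S.carrier, y ∉ (φ k).toFun '' K → χ k y • α y = 0) ∧
    (∀ y ∈ S.carrier, α y ≠ 0 → ∑ k, χ k y = 1) ∧
    c = ∑ k, (φ k).integral (fun y => χ k y • α y)

/-! ### Critical points -/

/-- The `d`-form `ι_{pr V} δL` on `ℝ^N`, evaluated on the field `u`, for the variation `V`: the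
components of the prolongation `pr V` are the partial derivatives `V_I`, `|I| ≤ n`. -/
def firstVariation {N n d : ℕ} (L : HorizontalForm N n d) (u : SmoothField N)
    (V : MultiTime N → ℝ) : MultiTime N → MultiTime N [⋀^Fin d]→L[ℝ] ℝ :=
  fun t => verticalD L (t, jet n u.toFun t) (jet n V t)

/-- The field `u` solves the pluri-Lagrangian problem for `L`: on every `d`-dimensional surface `S`
one has `∫_S ι_{pr V} δL = 0` for all variations `V` that vanish near the boundary of `S`. -/
def IsCritical {N n d : ℕ} (L : HorizontalForm N n d) (u : SmoothField N) : Prop :=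
  ∀ (S : OrientedSurface N d) (V : MultiTime N → ℝ), ContDiff ℝ ∞ V →
    (∀ y ∈ S.boundary, ∀ᶠ t in 𝓝 y, V t = 0) →
    ∀ c : ℝ, S.HasIntegral (firstVariation L u V) c → c = 0

end PluriLagrangian

end

/-!
Let `u` be a critical point and `V` a variation, and let `α = ι_{pr V} δL` on the field `u`, a
smooth `d`-form on `ℝ^N`. Since the vertical and the horizontal derivative commute,
`dα = ι_{pr V} δ(dL)` (`extDeriv_firstVariation`). Every jet at a point `t₀` is the jet of a `V`
supported in the unit ball about `t₀` (`exists_contDiff_jet_eq`), so part (1) amounts to `dα = 0` at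
`t₀` for such `V`. The test surfaces are graphs of functions `g` over a `d`-plane, in a direction
`w` transverse to it, over a ball so large that its boundary is off the support of `V`. The integral
of `α` over such a graph is zero for all `g`, and its derivative in the direction of `g` at the flat
plane is `∫ g · dα(w, v)`, where `v` spans the plane; hence `dα(w, v) = 0`
(`extDeriv_eq_zero_of_integral_graphMap_eq_zero`, `verticalD_horizontalD_eq_zero`).

For part (2), fix `t` and vectors `z`. The jets at `t` of the fields in `C` form a preconnected set
in a finite-dimensional space, and by part (1) they are critical points of the smooth function
`p ↦ dL(t, p)(z)`. A connected set of critical points need not contain any nonconstant path, and a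
function of low regularity need not be constant on it (Whitney's example); what is needed is Sard's
theorem (`volume_image_critical_eq_zero`), by which the image of the set is a null interval.
Finally, if `L` is autonomous, all the partial derivatives of `dL` at the jets of a critical point
`u` vanish, so that `dL` is constant along `u` (`eval_eq_of_autonomous`).
-/

noncomputable section

open MeasureTheory Set Filter

namespace PluriLagrangian

/-! ### Sard's theorem for real-valued functions -/

section

/-- Taylor's estimate at the points where the derivatives of order `1, …, k` vanish, uniformly in
the point. -/
lemma exists_norm_sub_le_pow_of_iteratedFDeriv_eq_zero {E : Type*} [NormedAddCommGroup E]
    [NormedSpace ℝ E] {f : E → ℝ} {x₀ : E} (k : ℕ) (hf : ContDiffAt ℝ (k + 1 : ℕ) f x₀) :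
    ∃ C : NNReal, ∃ t ∈ 𝓝 x₀, ∀ x ∈ t, (∀ i < k, iteratedFDeriv ℝ (i + 1) f x = 0) →
      ∀ y ∈ t, ‖f y - f x‖ ≤ C * ‖y - x‖ ^ (k + 1) := by
  have hev : ∀ᶠ y in 𝓝 x₀, ContDiffAt ℝ (k + 1 : ℕ) f y := hf.eventually (by simp)
  have hcont : ContinuousAt (iteratedFDeriv ℝ (k + 1) f) x₀ :=
    (hf.iteratedFDeriv_right (m := 0) (i := k + 1) (by simp)).continuousAt
  have hbd : ∀ᶠ y in 𝓝 x₀, ‖iteratedFDeriv ℝ (k + 1) f y‖ < ‖iteratedFDeriv ℝ (k + 1) f x₀‖ + 1 :=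
    hcont.norm.eventually_lt continuousAt_const (by simp)
  obtain ⟨r, hr, hball⟩ := Metric.eventually_nhds_iff_ball.1 (hev.and hbd)
  refine ⟨⟨‖iteratedFDeriv ℝ (k + 1) f x₀‖ + 1, by positivity⟩, Metric.ball x₀ r,
    Metric.ball_mem_nhds _ hr, fun x hx hzero => ?_⟩
  set C : ℝ := ‖iteratedFDeriv ℝ (k + 1) f x₀‖ + 1
  have hC : 0 ≤ C := by positivity
  -- Downward induction on the order of the derivative, by the mean value inequality.
  have key : ∀ j ≤ k, ∀ y ∈ Metric.ball x₀ r,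
      ‖iteratedFDeriv ℝ (k + 1 - j) f y‖ ≤ C * ‖y - x‖ ^ j := by
    intro j
    induction j with
    | zero => intro _ y hy; simpa using (hball y hy).2.le
    | succ j ih =>
      intro hj y hy
      obtain ⟨i, rfl⟩ : ∃ i, k = i + j + 1 := ⟨k - (j + 1), by omega⟩
      have h1 : i + j + 1 + 1 - (j + 1) = i + 1 := by omega
      have h2 : i + j + 1 + 1 - j = i + 1 + 1 := by omega
      rw [h1]
      rw [h2] at ih
      have hconv : Convex ℝ (Metric.ball x₀ r ∩ Metric.closedBall x ‖y - x‖) :=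
        (convex_ball _ _).inter (convex_closedBall _ _)
      have := hconv.norm_image_sub_le_of_norm_fderiv_le (𝕜 := ℝ)
        (f := iteratedFDeriv ℝ (i + 1) f) (C := C * ‖y - x‖ ^ j) (x := x) (y := y)
        (fun z hz => (((hball z hz.1).1.iteratedFDeriv_right (m := 1) (i := i + 1)
          (by norm_cast; omega)).differentiableAt (by simp)))
        (fun z hz => by
          rw [norm_fderiv_iteratedFDeriv]
          refine (ih (by omega) z hz.1).trans ?_
          gcongr
          simpa [dist_eq_norm] using hz.2)
        ⟨hx, by simp⟩ ⟨hy, by simp [dist_eq_norm]⟩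
      rw [hzero i (by omega), sub_zero] at this
      rwa [pow_succ, ← mul_assoc]
  intro y hy
  have hconv : Convex ℝ (Metric.ball x₀ r ∩ Metric.closedBall x ‖y - x‖) :=
    (convex_ball _ _).inter (convex_closedBall _ _)
  have := hconv.norm_image_sub_le_of_norm_fderiv_le (𝕜 := ℝ)
    (f := f) (C := C * ‖y - x‖ ^ k) (x := x) (y := y)
    (fun z hz => ((hball z hz.1).1.differentiableAt (by simp)))
    (fun z hz => by
      have := key k le_rfl z hz.1
      rw [Nat.add_sub_cancel_left, norm_iteratedFDeriv_one] at this
      refine this.trans ?_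
      gcongr
      simpa [dist_eq_norm] using hz.2)
    ⟨hx, by simp⟩ ⟨hy, by simp [dist_eq_norm]⟩
  rw [pow_succ, ← mul_assoc]
  exact this

/-- Near a regular zero of a `C^s` function `w`, the zero set of `w` is contained in the image
under a `C^s` map of any neighbourhood of `0` in the kernel of the derivative of `w`. -/
lemma exists_contDiffAt_param_of_fderiv_ne_zero {E : Type*} [NormedAddCommGroup E]
    [NormedSpace ℝ E] [FiniteDimensional ℝ E] {w : E → ℝ} {x : E} {s : ℕ} (hs : s ≠ 0)
    (hw : ContDiffAt ℝ s w x) (hx : w x = 0) (hd : fderiv ℝ w x ≠ 0) :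
    ∃ ψ : (fderiv ℝ w x).ker → E, ψ 0 = x ∧ ContDiffAt ℝ s ψ 0 ∧
      ∀ V ∈ 𝓝 (0 : (fderiv ℝ w x).ker), ∀ᶠ y in 𝓝 x, w y = 0 → y ∈ ψ '' V := by
  have hst : HasStrictFDerivAt w (fderiv ℝ w x) x :=
    hw.hasStrictFDerivAt (by exact_mod_cast hs)
  have hran : (fderiv ℝ w x).range = ⊤ :=
    LinearMap.range_eq_top.2 (LinearMap.surjective (f := (fderiv ℝ w x : E →ₗ[ℝ] ℝ))
      (fun h => hd (ContinuousLinearMap.coe_injective h)))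
  have : CompleteSpace E := FiniteDimensional.complete ℝ E
  have hker := (fderiv ℝ w x).ker_closedComplemented_of_finiteDimensional_range
  refine ⟨hst.implicitFunction w _ hran 0, ?_, ?_, ?_⟩
  · conv_lhs => rw [← hx]
    exact hst.implicitFunction_apply_image hran
  · let φ := HasStrictFDerivAt.implicitFunctionDataOfComplemented w (fderiv ℝ w x) hst hran hker
    have h1 : ContDiffAt ℝ s φ.implicitFunction.uncurry (φ.prodFun φ.pt) := by
      refine φ.contDiffAt_implicitFunction (n := s) hw ?_ (by exact_mod_cast hs)
      exact (ContinuousLinearMap.contDiff _).contDiffAt.comp _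
        (contDiffAt_id.sub contDiffAt_const)
    have h2 : φ.prodFun φ.pt = (0, 0) := by
      simp [φ, ImplicitFunctionData.prodFun, hx]
    rw [h2] at h1
    exact h1.comp (0 : (fderiv ℝ w x).ker) (contDiffAt_const.prodMk contDiffAt_id)
  · intro V hV
    have hcont : Tendsto (fun y => (hst.implicitToOpenPartialHomeomorph w _ hran y).2) (𝓝 x)
        (𝓝 0) := by
      have h := (hst.implicitToOpenPartialHomeomorph w _ hran).continuousAt
        (hst.mem_implicitToOpenPartialHomeomorph_source hran)
      have h' := (continuous_snd.tendsto _).comp h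
      simpa [Function.comp_def] using h'
    filter_upwards [hst.eq_implicitFunction hran, hcont hV] with y hy hyV hy0
    refine ⟨_, hyV, ?_⟩
    rw [hy0] at hy
    exact hy

/-- An order of differentiability that suffices for Sard's theorem in `m` variables. It is far from
optimal; passing to a level set of a derivative of order at most `m` loses `m` derivatives, and a
finite order, unlike `∞`, holds on a neighbourhood as soon as it holds at a point. -/
def sardOrder : ℕ → ℕ
  | 0 => 1
  | m + 1 => sardOrder m + m + 2

/-- **Sard's theorem** for real-valued functions: the set of critical values is null. By induction
on the dimension: where the derivatives of order at most `k` vanish and one of order `k + 1` does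
not, the critical points lie on a hypersurface; where all derivatives up to a high order vanish, `f`
is Hölder continuous of an exponent greater than the dimension. -/
theorem volume_image_critical_eq_zero (m : ℕ) : ∀ (E : Type*) [NormedAddCommGroup E]
    [NormedSpace ℝ E] [FiniteDimensional ℝ E], Module.finrank ℝ E = m → ∀ (f : E → ℝ) (U : Set E),
    IsOpen U → ContDiffOn ℝ (sardOrder m) f U →
    volume (f '' {x ∈ U | fderiv ℝ f x = 0}) = 0 := by
  induction m with
  | zero =>
    intro E _ _ _ hE f U hU hf
    have : Subsingleton E := Module.finrank_zero_iff.1 hE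
    exact (Set.subsingleton_of_subsingleton.image f).measure_zero _
  | succ m ih =>
    intro E _ _ _ hE f U hU hf
    have hfat : ∀ x ∈ U, ContDiffAt ℝ (sardOrder m + m + 2 : ℕ) f x := fun x hx =>
      hf.contDiffAt (hU.mem_nhds hx)
    -- The critical points at which all derivatives of order `1, …, k` vanish.
    let A : ℕ → Set E := fun k => {x ∈ U | ∀ i < k, iteratedFDeriv ℝ (i + 1) f x = 0}
    have hA1 : {x ∈ U | fderiv ℝ f x = 0} ⊆ A 1 := by
      rintro x ⟨hx, h0⟩
      refine ⟨hx, fun i hi => ?_⟩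
      obtain rfl : i = 0 := by omega
      rw [← norm_eq_zero, norm_iteratedFDeriv_one, h0, norm_zero]
    have hcover : {x ∈ U | fderiv ℝ f x = 0} ⊆
        A (m + 1) ∪ ⋃ k ∈ Finset.Icc 1 m, A k \ A (k + 1) := by
      intro x hx
      by_contra hcon
      simp only [mem_union, mem_iUnion, not_or, not_exists, Finset.mem_Icc, Set.mem_sdiff, not_and,
        not_not] at hcon
      refine hcon.1 (Nat.le_induction (m := 1) (P := fun j _ => j ≤ m + 1 → x ∈ A j)
        (fun _ => hA1 hx) (fun j hj IH hjm => ?_) (m + 1) (by omega) le_rfl)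
      exact hcon.2 j ⟨hj, by omega⟩ (IH (by omega))
    refine measure_mono_null (image_mono hcover) ?_
    rw [image_union, measure_union_null_iff]
    constructor
    · -- Where all derivatives of order at most `m + 1` vanish, `f` is Hölder of exponent `m + 2`.
      have hdim : dimH (f '' A (m + 1)) ≤ dimH (A (m + 1)) / ((m + 2 : ℕ) : NNReal) := by
        refine dimH_image_le_of_locally_holder_on (by positivity) fun x hx => ?_
        obtain ⟨C, t, ht, hC⟩ := exists_norm_sub_le_pow_of_iteratedFDeriv_eq_zero (m + 1)
          ((hfat x hx.1).of_le (by norm_cast; omega))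
        refine ⟨C, t ∩ A (m + 1), inter_mem (mem_nhdsWithin_of_mem_nhds ht) self_mem_nhdsWithin,
          fun y hy z hz => ?_⟩
        have := hC z hz.1 hz.2.2 y hy.1
        rw [edist_dist, edist_dist, dist_eq_norm, dist_eq_norm, NNReal.coe_natCast,
          ENNReal.rpow_natCast, ← ENNReal.ofReal_pow (norm_nonneg _), ← ENNReal.ofReal_coe_nnreal,
          ← ENNReal.ofReal_mul C.coe_nonneg]
        exact ENNReal.ofReal_le_ofReal this
      have hlt : dimH (f '' A (m + 1)) < (1 : NNReal) := by
        refine hdim.trans_lt ?_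
        refine (ENNReal.div_le_div_right (dimH_mono (subset_univ _)) _).trans_lt ?_
        rw [Real.dimH_univ_eq_finrank, hE]
        refine ENNReal.div_lt_of_lt_mul ?_
        rw [ENNReal.coe_one, one_mul]
        norm_cast
        omega
      have := hausdorffMeasure_of_dimH_lt hlt
      rwa [NNReal.coe_one, hausdorffMeasure_real] at this
    · rw [image_iUnion₂]
      refine (measure_biUnion_null_iff (Finset.Icc 1 m).countable_toSet).2 fun k hk => ?_
      have hk := Finset.mem_Icc.1 hk
      -- The outer measure `s ↦ volume (f '' s)` vanishes if it does so locally.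
      change OuterMeasure.comap f volume.toOuterMeasure _ = 0
      refine measure_null_of_locally_null _ fun x hx => ?_
      obtain ⟨hxk, hxk'⟩ := hx
      have hne : iteratedFDeriv ℝ (k + 1) f x ≠ 0 := by
        intro h0
        refine hxk' ⟨hxk.1, fun i hi => ?_⟩
        rcases Nat.lt_succ_iff_lt_or_eq.1 hi with h | rfl
        exacts [hxk.2 i h, h0]
      obtain ⟨v, hv⟩ : ∃ v, iteratedFDeriv ℝ (k + 1) f x v ≠ 0 := by
        by_contra! h
        exact hne (ContinuousMultilinearMap.ext h)
      -- A derivative of order `k` that vanishes on `A k` and has `x` as a regular point.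
      let w : E → ℝ := fun y => iteratedFDeriv ℝ k f y (Fin.tail v)
      have hwc : ContDiffAt ℝ (sardOrder m + 1 : ℕ) w x := by
        have := (hfat x hxk.1).iteratedFDeriv_right (m := (sardOrder m + 1 : ℕ)) (i := k)
          (by norm_cast; omega)
        exact (ContinuousMultilinearMap.apply ℝ (fun _ : Fin k => E) ℝ
          (Fin.tail v)).contDiff.contDiffAt.comp x this
      have hwd : fderiv ℝ w x (v 0) = iteratedFDeriv ℝ (k + 1) f x v := by
        rw [iteratedFDeriv_succ_apply_left]
        have hdiff : DifferentiableAt ℝ (iteratedFDeriv ℝ k f) x :=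
          ((hfat x hxk.1).iteratedFDeriv_right (m := 1) (i := k)
          (by norm_cast; omega)).differentiableAt (by simp)
        rw [show w = ContinuousMultilinearMap.apply ℝ (fun _ : Fin k => E) ℝ
          (Fin.tail v) ∘ iteratedFDeriv ℝ k f from rfl, fderiv_comp _ (by fun_prop) hdiff]
        simp
      have hwz : ∀ y ∈ A k, w y = 0 := fun y hy => by
        have := hy.2 (k - 1) (by omega)
        rw [Nat.sub_add_cancel hk.1] at this
        simp [w, this]
      have hw0 : fderiv ℝ w x ≠ 0 := fun h => hv (by rw [← hwd, h]; rfl)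
      obtain ⟨ψ, hψ0, hψ, hψV⟩ := exists_contDiffAt_param_of_fderiv_ne_zero
        (s := sardOrder m + 1) (by simp) hwc (hwz x hxk) hw0
      have hker : Module.finrank ℝ (fderiv ℝ w x).ker = m := by
        have h1 := LinearMap.finrank_range_add_finrank_ker (fderiv ℝ w x : E →ₗ[ℝ] ℝ)
        have h2 : (fderiv ℝ w x : E →ₗ[ℝ] ℝ).range = ⊤ :=
          LinearMap.range_eq_top.2 (LinearMap.surjective
            (fun h => hw0 (ContinuousLinearMap.coe_injective h)))
        rw [h2, finrank_top, Module.finrank_self, hE] at h1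
        exact Nat.add_left_cancel (n := 1) (by rw [add_comm 1 m]; exact h1)
      have hev : ∀ᶠ z in 𝓝 (0 : (fderiv ℝ w x).ker),
          ContDiffAt ℝ (sardOrder m + 1 : ℕ) ψ z ∧ ψ z ∈ U :=
        (hψ.eventually (by simp)).and
          (hψ.continuousAt.eventually_mem (by rw [hψ0]; exact hU.mem_nhds hxk.1))
      obtain ⟨V, hVsub, hVo, hV0⟩ := mem_nhds_iff.1 hev
      refine ⟨ψ '' V ∩ A k, ?_, ?_⟩
      · filter_upwards [mem_nhdsWithin_of_mem_nhds (hψV V (hVo.mem_nhds hV0)),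
          self_mem_nhdsWithin] with y hy hyA
        exact ⟨hy (hwz y hyA.1), hyA.1⟩
      · change volume (f '' _) = 0
        refine measure_mono_null ?_ (ih (fderiv ℝ w x).ker hker (f ∘ ψ) V hVo ?_)
        · rintro _ ⟨_, ⟨⟨z, hz, rfl⟩, hzA⟩, rfl⟩
          refine ⟨z, ⟨hz, ?_⟩, rfl⟩
          have hz' := hVsub hz
          have hf0 : fderiv ℝ f (ψ z) = 0 := by
            rw [← norm_eq_zero, ← norm_iteratedFDeriv_one, hzA.2 0 (by omega), norm_zero]
          rw [fderiv_comp _ ((hfat _ hz'.2).differentiableAt (by simp))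
            (hz'.1.differentiableAt (by simp)), hf0, ContinuousLinearMap.zero_comp]
        · intro z hz
          have hz' := hVsub hz
          exact (((hfat _ hz'.2).of_le (by norm_cast; omega)).comp z
            (hz'.1.of_le (by norm_cast; omega))).contDiffWithinAt

end

/-! ### Partial derivatives and jets -/

section

variable {N : ℕ}

lemma pd_eventuallyEq {f g : MultiTime N → ℝ} {t : MultiTime N} (i : Fin N) (h : f =ᶠ[𝓝 t] g) :
    pd i f =ᶠ[𝓝 t] pd i g := by
  filter_upwards [h.fderiv (𝕜 := ℝ)] with s hs
  simp only [pd, hs]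

lemma iterate_pd_eventuallyEq {f g : MultiTime N → ℝ} {t : MultiTime N} (i : Fin N) (k : ℕ)
    (h : f =ᶠ[𝓝 t] g) : (pd i)^[k] f =ᶠ[𝓝 t] (pd i)^[k] g := by
  induction k with
  | zero => exact h
  | succ k ih =>
    rw [Function.iterate_succ_apply', Function.iterate_succ_apply']
    exact pd_eventuallyEq i ih

lemma mpd_eventuallyEq {f g : MultiTime N → ℝ} {t : MultiTime N} (I : Fin N → ℕ)
    (h : f =ᶠ[𝓝 t] g) : mpd I f =ᶠ[𝓝 t] mpd I g := by
  unfold mpd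
  induction List.finRange N with
  | nil => exact h
  | cons i l ih => exact iterate_pd_eventuallyEq i (I i) ih

lemma jet_congr {f g : MultiTime N → ℝ} {t : MultiTime N} (n : ℕ) (h : f =ᶠ[𝓝 t] g) :
    jet n f t = jet n g t :=
  funext fun I => (mpd_eventuallyEq I.1 h).eq_of_nhds

lemma mpd_zero (I : Fin N → ℕ) : mpd I (fun _ => 0) = fun _ => 0 := by
  have h1 : ∀ i : Fin N, pd i (fun _ => 0) = fun _ => 0 := fun i => by
    ext t; simp [pd]
  have h2 : ∀ (i : Fin N) (k : ℕ), (pd i)^[k] (fun _ => 0) = fun _ => 0 := fun i k =>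
    Function.iterate_fixed (h1 i) k
  unfold mpd
  induction List.finRange N with
  | nil => rfl
  | cons i l ih => rw [List.foldr_cons, ih, h2]

lemma jet_eq_zero {f : MultiTime N → ℝ} {t : MultiTime N} (n : ℕ) (h : ∀ᶠ s in 𝓝 t, f s = 0) :
    jet n f t = 0 := by
  rw [jet_congr n (g := fun _ => 0) h]
  ext I
  simp [jet, mpd_zero]

lemma contDiff_iterate_pd (i : Fin N) (k : ℕ) {f : MultiTime N → ℝ} (hf : ContDiff ℝ ∞ f) :
    ContDiff ℝ ∞ ((pd i)^[k] f) := by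
  induction k with
  | zero => exact hf
  | succ k ih => rw [Function.iterate_succ_apply']; exact contDiff_pd i ih

lemma pd_comm (i j : Fin N) {f : MultiTime N → ℝ} (hf : ContDiff ℝ ∞ f) :
    pd i (pd j f) = pd j (pd i f) := by
  have hd : Differentiable ℝ (fderiv ℝ f) :=
    (hf.fderiv_right (m := ∞) (by simp)).differentiable (by simp)
  have key : ∀ (i j : Fin N) (t : MultiTime N), pd i (pd j f) t =
      fderiv ℝ (fderiv ℝ f) t (EuclideanSpace.single i 1) (EuclideanSpace.single j 1) := by
    intro i j t
    have := ((hd t).hasFDerivAt.clm_apply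
      (hasFDerivAt_const (EuclideanSpace.single j (1 : ℝ)) t)).fderiv
    unfold pd
    rw [this]
    simp
  ext t
  rw [key, key]
  exact hf.contDiffAt.isSymmSndFDerivAt
    (by rw [minSmoothness_of_isRCLikeNormedField]; exact WithTop.coe_le_coe.2 le_top) _ _

lemma pd_iterate_pd_comm (i j : Fin N) (k : ℕ) {f : MultiTime N → ℝ} (hf : ContDiff ℝ ∞ f) :
    pd i ((pd j)^[k] f) = (pd j)^[k] (pd i f) := by
  induction k with
  | zero => rfl
  | succ k ih =>
    rw [Function.iterate_succ_apply', Function.iterate_succ_apply',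
      pd_comm i j (contDiff_iterate_pd j k hf), ih]

lemma contDiff_foldr_pd (I : Fin N → ℕ) (l : List (Fin N)) {f : MultiTime N → ℝ}
    (hf : ContDiff ℝ ∞ f) : ContDiff ℝ ∞ (l.foldr (fun i g => (pd i)^[I i] g) f) := by
  induction l with
  | nil => exact hf
  | cons i l ih => exact contDiff_iterate_pd i (I i) ih

/-- The commutation of the partial derivatives gives `∂_j f_I = f_{Ij}`. -/
lemma pd_mpd (I : Fin N → ℕ) (j : Fin N) {f : MultiTime N → ℝ} (hf : ContDiff ℝ ∞ f) :
    pd j (mpd I f) = mpd (I + Pi.single j 1) f := by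
  -- The product over a sublist of the coordinates contains the additional `∂_j` once or not at all.
  have key : ∀ l : List (Fin N), l.Nodup →
      l.foldr (fun i g => (pd i)^[(I + Pi.single j 1 : Fin N → ℕ) i] g) f =
     
      if j ∈ l then pd j (l.foldr (fun i g => (pd i)^[I i] g) f)
      else l.foldr (fun i g => (pd i)^[I i] g) f := by
    intro l hl
    induction l with
    | nil => simp
    | cons i l ih =>
      rw [List.nodup_cons] at hl
      rw [List.foldr_cons, ih hl.2]
      by_cases hij : i = j
      · subst hij
        rw [if_neg hl.1, if_pos List.mem_cons_self]
        simp [Function.iterate_succ_apply']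
      · have h0 : (I + Pi.single j 1 : Fin N → ℕ) i = I i := by simp [hij]
        have h1 : j ∈ i :: l ↔ j ∈ l := by simp [Ne.symm hij]
        rw [h0]
        by_cases hjl : j ∈ l
        · rw [if_pos hjl, if_pos (h1.2 hjl), List.foldr_cons,
            pd_iterate_pd_comm _ _ _ (contDiff_foldr_pd I l hf)]
        · rw [if_neg hjl, if_neg (mt h1.1 hjl), List.foldr_cons]
  have := key (List.finRange N) (List.nodup_finRange N)
  rw [if_pos (List.mem_finRange j)] at this
  exact this.symm

lemma fderiv_eq_sum_pd (f : MultiTime N → ℝ) (t v : MultiTime N) :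
    fderiv ℝ f t v = ∑ j, v j * pd j f t := by
  conv_lhs => rw [← (EuclideanSpace.basisFun (Fin N) ℝ).sum_repr v]
  simp [pd]

/-- Along the graph of a jet prolongation, the total derivatives are the partial derivatives. -/
lemma hasFDerivAt_jet (n : ℕ) {f : MultiTime N → ℝ} (hf : ContDiff ℝ ∞ f) (t : MultiTime N) :
    HasFDerivAt (jet n f) ((ContinuousLinearMap.snd ℝ (MultiTime N) (Jet N n)).comp
      (totalLift (jet (n + 1) f t))) t := by
  rw [hasFDerivAt_pi']
  intro I
  have h := ((contDiff_mpd I.1 hf).differentiable (by simp) t).hasFDerivAt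
  refine h.congr_fderiv ?_
  ext v
  rw [fderiv_eq_sum_pd]
  simp [totalLift, jet, MultiIndex.shift, pd_mpd I.1 _ hf, mul_comm]

lemma hasFDerivAt_prodMk_jet (n : ℕ) {f : MultiTime N → ℝ} (hf : ContDiff ℝ ∞ f)
    (t : MultiTime N) :
    HasFDerivAt (fun s => (s, jet n f s)) (totalLift (jet (n + 1) f t)) t := by
  refine ((hasFDerivAt_id t).prodMk (hasFDerivAt_jet n hf t)).congr_fderiv ?_
  ext v <;> simp [totalLift]

lemma contDiff_jet (n : ℕ) {f : MultiTime N → ℝ} (hf : ContDiff ℝ ∞ f) :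
    ContDiff ℝ ∞ (jet n f) :=
  contDiff_pi.2 fun I => contDiff_mpd I.1 hf

lemma pd_sum {ι : Type*} [Fintype ι] (c : ι → ℝ) (f : ι → MultiTime N → ℝ)
    (hf : ∀ k, ContDiff ℝ ∞ (f k)) (i : Fin N) :
    pd i (fun t => ∑ k, c k * f k t) = fun t => ∑ k, c k * pd i (f k) t := by
  ext t
  have h : HasFDerivAt (fun t => ∑ k, c k * f k t) (∑ k, c k • fderiv ℝ (f k) t) t :=
    HasFDerivAt.fun_sum fun k _ =>
      (((hf k).differentiable (by simp) t).hasFDerivAt).const_mul (c k)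
  simp [pd, h.fderiv]

lemma mpd_sum {ι : Type*} [Fintype ι] (c : ι → ℝ) (f : ι → MultiTime N → ℝ)
    (hf : ∀ k, ContDiff ℝ ∞ (f k)) (I : Fin N → ℕ) :
    mpd I (fun t => ∑ k, c k * f k t) = fun t => ∑ k, c k * mpd I (f k) t := by
  unfold mpd
  induction List.finRange N with
  | nil => rfl
  | cons i l ih =>
    simp only [List.foldr_cons]
    rw [ih]
    induction I i with
    | zero => rfl
    | succ m ihm =>
      simp only [Function.iterate_succ_apply']
      rw [ihm, pd_sum]
      exact fun k => contDiff_iterate_pd i m (contDiff_foldr_pd I l (hf k))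

/-- The product `t ↦ ∏ j, φ j (t j)` of functions of one variable. -/
def tensorFun (φ : Fin N → ℝ → ℝ) : MultiTime N → ℝ := fun t => ∏ j, φ j (t j)

lemma contDiff_tensorFun {φ : Fin N → ℝ → ℝ} (hφ : ∀ j, ContDiff ℝ ∞ (φ j)) :
    ContDiff ℝ ∞ (tensorFun φ) :=
  contDiff_prod fun j _ => (hφ j).comp (EuclideanSpace.proj (𝕜 := ℝ) j).contDiff

lemma pd_tensorFun {φ : Fin N → ℝ → ℝ} (hφ : ∀ j, ContDiff ℝ ∞ (φ j)) (i : Fin N) :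
    pd i (tensorFun φ) = tensorFun (Function.update φ i (deriv (φ i))) := by
  ext t
  have h : HasFDerivAt (tensorFun φ) _ t :=
    HasFDerivAt.finsetProd (u := Finset.univ) (g := fun j (t : MultiTime N) => φ j (t j))
      fun j _ => (((hφ j).differentiable (by simp) (t j)).hasDerivAt.comp_hasFDerivAt t
        (EuclideanSpace.proj (𝕜 := ℝ) j).hasFDerivAt)
  simp only [pd, h.fderiv, tensorFun]
  rw [← Finset.mul_prod_erase _ _ (Finset.mem_univ i), Function.update_self,
    Finset.prod_congr rfl (g := fun j => φ j (t j)) fun j hj => by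
      rw [Function.update_of_ne (Finset.ne_of_mem_erase hj)]]
  simp [mul_comm]

lemma contDiff_iteratedDeriv_of_contDiff {f : ℝ → ℝ} (hf : ContDiff ℝ ∞ f) (k : ℕ) :
    ContDiff ℝ ∞ (iteratedDeriv k f) :=
  iteratedDeriv_eq_iterate (𝕜 := ℝ) (F := ℝ) ▸ hf.iterate_deriv k

lemma iterate_pd_tensorFun {φ : Fin N → ℝ → ℝ} (hφ : ∀ j, ContDiff ℝ ∞ (φ j)) (i : Fin N)
    (k : ℕ) :
    (pd i)^[k] (tensorFun φ) = tensorFun (Function.update φ i (iteratedDeriv k (φ i))) := by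
  induction k with
  | zero => simp
  | succ k ih =>
    rw [Function.iterate_succ_apply', ih, pd_tensorFun]
    · simp [iteratedDeriv_succ]
    · intro j
      rcases eq_or_ne j i with rfl | hj
      · simpa using contDiff_iteratedDeriv_of_contDiff (hφ j) k
      · simpa [hj] using hφ j

lemma mpd_tensorFun {φ : Fin N → ℝ → ℝ} (hφ : ∀ j, ContDiff ℝ ∞ (φ j)) (I : Fin N → ℕ) :
    mpd I (tensorFun φ) = tensorFun fun j => iteratedDeriv (I j) (φ j) := by
  have key : ∀ l : List (Fin N), l.Nodup → l.foldr (fun i g => (pd i)^[I i] g) (tensorFun φ) =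
      tensorFun fun j => if j ∈ l then iteratedDeriv (I j) (φ j) else φ j := by
    intro l hl
    induction l with
    | nil => simp
    | cons i l ih =>
      rw [List.nodup_cons] at hl
      rw [List.foldr_cons, ih hl.2, iterate_pd_tensorFun]
      · congr 1
        ext1 j
        rcases eq_or_ne j i with rfl | hj
        · simp [hl.1]
        · simp [hj]
      · intro j
        split_ifs
        exacts [contDiff_iteratedDeriv_of_contDiff (hφ j) _, hφ j]
  simpa [mpd] using key (List.finRange N) (List.nodup_finRange N)

lemma iteratedDeriv_sub_pow_div_factorial (a : ℝ) (k m : ℕ) :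
    iteratedDeriv m (fun s => (s - a) ^ k / k.factorial) a = if m = k then 1 else 0 := by
  rw [iteratedDeriv_comp_sub_const m (fun s : ℝ => s ^ k / (k.factorial : ℝ)) a]
  simp_rw [div_eq_mul_inv, mul_comm _ ((k.factorial : ℝ)⁻¹)]
  rw [iteratedDeriv_const_mul_field, sub_self, iteratedDeriv_fun_pow_zero]
  split_ifs
  · exact inv_mul_cancel₀ (by positivity)
  · simp

/-- Every `n`-jet at `t₀` is the jet of a smooth function supported in the unit ball about `t₀`. -/
lemma exists_contDiff_jet_eq (n : ℕ) (t₀ : MultiTime N) (a : Jet N n) :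
    ∃ V : MultiTime N → ℝ, ContDiff ℝ ∞ V ∧ (∀ t, 1 < ‖t - t₀‖ → ∀ᶠ s in 𝓝 t, V s = 0) ∧
      jet n V t₀ = a := by
  -- A bump function times the Taylor polynomial with the prescribed coefficients.
  let ρ : ContDiffBump t₀ := ⟨1 / 2, 1, by norm_num, by norm_num⟩
  let φ : MultiIndex N n → Fin N → ℝ → ℝ :=
    fun K j s => (s - t₀ j) ^ K.1 j / (K.1 j).factorial
  have hφ : ∀ K j, ContDiff ℝ ∞ (φ K j) := fun K j => by fun_prop
  let P : MultiTime N → ℝ := fun t => ∑ K, a K * tensorFun (φ K) t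
  have hP : ContDiff ℝ ∞ P :=
    ContDiff.sum fun K _ => contDiff_const.mul (contDiff_tensorFun (hφ K))
  refine ⟨fun t => ρ t * P t, ρ.contDiff.mul hP, fun t ht => ?_, ?_⟩
  · have : ∀ᶠ s in 𝓝 t, 1 < ‖s - t₀‖ :=
      (by fun_prop : Continuous fun s => ‖s - t₀‖).continuousAt.eventually_const_lt ht
    filter_upwards [this] with s hs
    rw [ρ.zero_of_le_dist (by rw [dist_eq_norm]; exact hs.le), zero_mul]
  · rw [jet_congr n (g := P)]
    · ext I
      simp only [jet, P]
      rw [mpd_sum _ _ fun K => contDiff_tensorFun (hφ K)]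
      simp only [mpd_tensorFun (hφ _), tensorFun, φ, iteratedDeriv_sub_pow_div_factorial]
      rw [Finset.sum_eq_single I]
      · simp
      · intro K _ hK
        obtain ⟨j, hj⟩ : ∃ j, I.1 j ≠ K.1 j := by
          by_contra! h
          exact hK (Subtype.ext (funext fun j => (h j).symm))
        rw [Finset.prod_eq_zero (Finset.mem_univ j) (by simp [hj]), mul_zero]
      · simp
    · filter_upwards [ρ.eventuallyEq_one] with s hs
      rw [hs, Pi.one_apply, one_mul]

end

/-! ### Horizontal and vertical derivatives -/

section

variable {N : ℕ}

lemma verticalD_eq {n q : ℕ} {η : HorizontalForm N n q} (hη : Differentiable ℝ η)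
    (x : MultiTime N × Jet N n) :
    verticalD η x = (fderiv ℝ η x).comp (ContinuousLinearMap.inr ℝ (MultiTime N) (Jet N n)) := by
  have h : HasFDerivAt (fun p : Jet N n => (x.1, p))
      (ContinuousLinearMap.inr ℝ (MultiTime N) (Jet N n)) x.2 := hasFDerivAt_prodMk_right x.1 x.2
  exact ((hη x).hasFDerivAt.comp x.2 h).fderiv

/-- The projection of jets of order `n + 1` to jets of order `n`. -/
def truncateJet (N n : ℕ) : Jet N (n + 1) →L[ℝ] Jet N n :=
  ContinuousLinearMap.pi fun I => ContinuousLinearMap.proj I.weaken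

/-- The linear part of the affine map `totalLift`. -/
def totalLiftLinear (N n : ℕ) : Jet N (n + 1) →L[ℝ] MultiTime N →L[ℝ] MultiTime N × Jet N n :=
  LinearMap.toContinuousLinearMap
    { toFun := fun p => totalLift p - totalLift 0
      map_add' := fun p q => by
        ext v <;> simp [totalLift, add_mul, Finset.sum_add_distrib]
      map_smul' := fun c p => by
        ext v <;> simp [totalLift, mul_assoc, Finset.mul_sum] }

lemma totalLift_eq {n : ℕ} (p : Jet N (n + 1)) :
    totalLift p = totalLift 0 + totalLiftLinear N n p := by
  simp [totalLiftLinear]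

lemma totalLiftLinear_apply {n : ℕ} (p : Jet N (n + 1)) (v : MultiTime N) :
    totalLiftLinear N n p v = (0, (totalLift p v).2) := by
  ext <;> simp [totalLiftLinear, totalLift]

lemma contDiff_horizontalD {n q : ℕ} {η : HorizontalForm N n q} (hη : ContDiff ℝ ∞ η) :
    ContDiff ℝ ∞ (horizontalD η) := by
  have h1 : ContDiff ℝ ∞ fun x : MultiTime N × Jet N (n + 1) =>
      fderiv ℝ η (x.1, truncateJet N n x.2) :=
    (hη.fderiv_right (m := ∞) (by simp)).comp
      (contDiff_fst.prodMk ((truncateJet N n).contDiff.comp contDiff_snd))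
  have h2 : ContDiff ℝ ∞ fun x : MultiTime N × Jet N (n + 1) => totalLift x.2 := by
    simp_rw [fun x : MultiTime N × Jet N (n + 1) => totalLift_eq x.2]
    exact contDiff_const.add ((totalLiftLinear N n).contDiff.comp contDiff_snd)
  exact (ContinuousAlternatingMap.alternatizeUncurryFinCLM ℝ (MultiTime N) ℝ).contDiff.comp
    (h1.clm_comp h2)

lemma contDiff_firstVariation {n d : ℕ} {L : HorizontalForm N n d} (hL : ContDiff ℝ ∞ L)
    (u : SmoothField N) {V : MultiTime N → ℝ} (hV : ContDiff ℝ ∞ V) :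
    ContDiff ℝ ∞ (firstVariation L u V) := by
  unfold firstVariation
  simp_rw [verticalD_eq (hL.differentiable (by simp)), ContinuousLinearMap.comp_apply]
  exact ((hL.fderiv_right (m := ∞) (by simp)).comp
    (contDiff_id.prodMk (contDiff_jet n u.smooth))).clm_apply
    ((ContinuousLinearMap.inr ℝ (MultiTime N) (Jet N n)).contDiff.comp (contDiff_jet n hV))

/-- The derivative of `s ↦ Df (c s) (w s)`, rearranged by the symmetry of the second derivative. -/
lemma hasFDerivAt_fderiv_apply {E X G : Type*} [NormedAddCommGroup E] [NormedSpace ℝ E]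
    [NormedAddCommGroup X] [NormedSpace ℝ X] [NormedAddCommGroup G] [NormedSpace ℝ G]
    {f : E → G} (hf : ContDiff ℝ ∞ f) {c w : X → E} {c' w' : X →L[ℝ] E} {t : X}
    (hc : HasFDerivAt c c' t) (hw : HasFDerivAt w w' t) :
    HasFDerivAt (fun s => fderiv ℝ f (c s) (w s))
      ((fderiv ℝ (fderiv ℝ f) (c t) (w t)).comp c' + (fderiv ℝ f (c t)).comp w') t := by
  have hDf : Differentiable ℝ (fderiv ℝ f) :=
    (hf.fderiv_right (m := ∞) (by simp)).differentiable (by simp)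
  refine (((hDf (c t)).hasFDerivAt.comp t hc).clm_apply hw).congr_fderiv ?_
  ext v
  have hsymm := hf.contDiffAt.isSymmSndFDerivAt (x := c t)
    (by rw [minSmoothness_of_isRCLikeNormedField]; exact WithTop.coe_le_coe.2 le_top)
    (c' v) (w t)
  simp [hsymm, add_comm]

lemma fderiv_apply_fderiv_comp {E X J G H : Type*} [NormedAddCommGroup E] [NormedSpace ℝ E]
    [NormedAddCommGroup X] [NormedSpace ℝ X] [NormedAddCommGroup J] [NormedSpace ℝ J]
    [NormedAddCommGroup G] [NormedSpace ℝ G] [NormedAddCommGroup H] [NormedSpace ℝ H]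
    {f : E → G} (hf : ContDiff ℝ ∞ f) (Φ : (X →L[ℝ] G) →L[ℝ] H) {c : J → E} {c' : J →L[ℝ] E}
    {T : J → X →L[ℝ] E} {T' : J →L[ℝ] X →L[ℝ] E} {p : J}
    (hc : HasFDerivAt c c' p) (hT : HasFDerivAt T T' p) (a : J) :
    fderiv ℝ (fun q => Φ ((fderiv ℝ f (c q)).comp (T q))) p a =
      Φ ((fderiv ℝ (fderiv ℝ f) (c p) (c' a)).comp (T p) + (fderiv ℝ f (c p)).comp (T' a)) := by
  have hDf : Differentiable ℝ (fderiv ℝ f) :=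
    (hf.fderiv_right (m := ∞) (by simp)).differentiable (by simp)
  have h := Φ.hasFDerivAt.comp p (((hDf (c p)).hasFDerivAt.comp p hc).clm_comp hT)
  refine (DFunLike.congr_fun h.fderiv a).trans (congrArg Φ ?_)
  ext v
  simp [add_comm]

lemma verticalD_horizontalD_apply {n d : ℕ} {L : HorizontalForm N n d} (hL : ContDiff ℝ ∞ L)
    (t : MultiTime N) (p a : Jet N (n + 1)) :
    verticalD (horizontalD L) (t, p) a = ContinuousAlternatingMap.alternatizeUncurryFin
      ((fderiv ℝ (fderiv ℝ L) (t, truncateJet N n p)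
          (ContinuousLinearMap.inr ℝ (MultiTime N) (Jet N n) (truncateJet N n a))).comp
          (totalLift p) +
        (fderiv ℝ L (t, truncateJet N n p)).comp (totalLiftLinear N n a)) := by
  have h1 : HasFDerivAt (fun q : Jet N (n + 1) => (t, truncateJet N n q))
      ((ContinuousLinearMap.inr ℝ (MultiTime N) (Jet N n)).comp (truncateJet N n)) p :=
    (hasFDerivAt_prodMk_right t _).comp p (truncateJet N n).hasFDerivAt
  have h2 : HasFDerivAt (totalLift : Jet N (n + 1) → _) (totalLiftLinear N n) p :=
    ((totalLiftLinear N n).hasFDerivAt.const_add (totalLift 0)).congr_of_eventuallyEq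
      (.of_forall totalLift_eq)
  exact fderiv_apply_fderiv_comp hL
    (ContinuousAlternatingMap.alternatizeUncurryFinCLM ℝ (MultiTime N) ℝ) h1 h2 a

/-- The vertical and the horizontal exterior derivative commute: the exterior derivative of the form
`ι_{pr V} δL` on the field `u` is `ι_{pr V} δ(dL)` on `u`. -/
lemma extDeriv_firstVariation {n d : ℕ} {L : HorizontalForm N n d} (hL : ContDiff ℝ ∞ L)
    (u : SmoothField N) {V : MultiTime N → ℝ} (hV : ContDiff ℝ ∞ V) (t : MultiTime N) :
    extDeriv (firstVariation L u V) t =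
      verticalD (horizontalD L) (t, jet (n + 1) u.toFun t) (jet (n + 1) V t) := by
  have e : firstVariation L u V = fun s => fderiv ℝ L (s, jet n u.toFun s)
      (ContinuousLinearMap.inr ℝ (MultiTime N) (Jet N n) (jet n V s)) := by
    ext1 s
    rw [firstVariation, verticalD_eq (hL.differentiable (by simp)),
      ContinuousLinearMap.comp_apply]
  have h1 := (hasFDerivAt_fderiv_apply hL (hasFDerivAt_prodMk_jet n u.smooth t)
    ((ContinuousLinearMap.inr ℝ (MultiTime N) (Jet N n)).hasFDerivAt.comp t
      (hasFDerivAt_jet n hV t))).fderiv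
  have h3 : totalLiftLinear N n (jet (n + 1) V t) =
      (ContinuousLinearMap.inr ℝ (MultiTime N) (Jet N n)).comp
        ((ContinuousLinearMap.snd ℝ (MultiTime N) (Jet N n)).comp
          (totalLift (jet (n + 1) V t))) := by
    ext1 v
    rw [totalLiftLinear_apply]
    rfl
  have h4 : truncateJet N n (jet (n + 1) u.toFun t) = jet n u.toFun t := rfl
  have h5 : truncateJet N n (jet (n + 1) V t) = jet n V t := rfl
  rw [extDeriv, e, verticalD_horizontalD_apply hL, h3, h4, h5]
  exact congrArg _ h1

end

/-! ### Integration of forms over graphs -/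

section

lemma alternatizeUncurryFin_cons {F : Type*} [NormedAddCommGroup F] [NormedSpace ℝ F] {d : ℕ}
    (f : F →L[ℝ] F [⋀^Fin d]→L[ℝ] ℝ) (w : F) (v : Fin d → F) :
    ContinuousAlternatingMap.alternatizeUncurryFin f (Fin.cons w v) =
      f w v - ∑ i, f (v i) (Function.update v i w) := by
  rw [ContinuousAlternatingMap.alternatizeUncurryFin_apply, Fin.sum_univ_succ, sub_eq_add_neg,
    ← Finset.sum_neg_distrib]
  congr 1
  · simp
  · refine Finset.sum_congr rfl fun i _ => ?_
    cases d with
    | zero => exact i.elim0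
    | succ d =>
      have h1 : i.succ.removeNth (Fin.cons w v : Fin (d + 2) → F) =
          Matrix.vecCons w (i.removeNth v) := by
        ext j
        refine Fin.cases ?_ (fun j => ?_) j <;> simp [Fin.removeNth]
      have h2 : Function.update v i w = i.insertNth w (i.removeNth v) := by
        rw [Fin.insertNth_removeNth]
      rw [h1, h2, ContinuousAlternatingMap.map_insertNth]
      simp [pow_succ]

variable {F : Type*} [NormedAddCommGroup F] [NormedSpace ℝ F] {d : ℕ}

/-- The affine parametrization `x ↦ t₀ + ∑ i, x i • v i`, bent in the direction `w` by the
function `g`. -/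
def graphMap (t₀ : F) (v : Fin d → F) (w : F) (g : EuclideanSpace ℝ (Fin d) → ℝ)
    (x : EuclideanSpace ℝ (Fin d)) : F :=
  t₀ + ∑ i, x i • v i + g x • w

lemma hasFDerivAt_graphMap (t₀ : F) (v : Fin d → F) (w : F) {g : EuclideanSpace ℝ (Fin d) → ℝ}
    (hg : Differentiable ℝ g) (x : EuclideanSpace ℝ (Fin d)) :
    HasFDerivAt (graphMap t₀ v w g)
      (∑ i, (EuclideanSpace.proj i : EuclideanSpace ℝ (Fin d) →L[ℝ] ℝ).smulRight (v i) +
        (fderiv ℝ g x).smulRight w) x := by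
  refine HasFDerivAt.add (HasFDerivAt.const_add _ (HasFDerivAt.fun_sum fun i _ => ?_))
    ((hg x).hasFDerivAt.smul_const w)
  exact (EuclideanSpace.proj (𝕜 := ℝ) i).hasFDerivAt.smul_const (v i)

lemma contDiff_graphMap (t₀ : F) (v : Fin d → F) (w : F) {g : EuclideanSpace ℝ (Fin d) → ℝ}
    (hg : ContDiff ℝ ∞ g) : ContDiff ℝ ∞ (graphMap t₀ v w g) := by
  unfold graphMap
  fun_prop

lemma fderiv_graphMap_single (t₀ : F) (v : Fin d → F) (w : F)
    {g : EuclideanSpace ℝ (Fin d) → ℝ} (hg : Differentiable ℝ g) (x : EuclideanSpace ℝ (Fin d))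
    (i : Fin d) :
    fderiv ℝ (graphMap t₀ v w g) x (EuclideanSpace.single i 1) =
      v i + fderiv ℝ g x (EuclideanSpace.single i 1) • w := by
  rw [(hasFDerivAt_graphMap t₀ v w hg x).fderiv]
  simp [ite_smul]

/-- A linear map that reads off the coordinates along `v` and kills `w` inverts the graph map. -/
lemma apply_graphMap_sub {t₀ : F} {v : Fin d → F} {w : F}
    {π : F →L[ℝ] EuclideanSpace ℝ (Fin d)} (hπv : ∀ i, π (v i) = EuclideanSpace.single i 1)
    (hπw : π w = 0) (g : EuclideanSpace ℝ (Fin d) → ℝ) (x : EuclideanSpace ℝ (Fin d)) :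
    π (graphMap t₀ v w g x - t₀) = x := by
  have : graphMap t₀ v w g x - t₀ = ∑ i, x i • v i + g x • w := by
    rw [graphMap]; abel
  rw [this, map_add, map_sum, map_smul, hπw, smul_zero, add_zero]
  simp_rw [map_smul, hπv]
  simpa using (EuclideanSpace.basisFun (Fin d) ℝ).sum_repr x

/-- If a smooth form with bounded support has vanishing integral over all the graphs in direction
`w` over the plane spanned by `v`, its exterior derivative vanishes on `(w, v)`: the derivative of
the integral with respect to the graph function `g` is `∫ g · dα (w, v)`. -/
lemma extDeriv_eq_zero_of_integral_graphMap_eq_zero {α : F → F [⋀^Fin d]→L[ℝ] ℝ}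
    (hα : ContDiff ℝ ∞ α) {t₀ : F} {r : ℝ} (hsupp : ∀ y, r < ‖y - t₀‖ → α y = 0)
    {v : Fin d → F} {w : F} {π : F →L[ℝ] EuclideanSpace ℝ (Fin d)}
    (hπv : ∀ i, π (v i) = EuclideanSpace.single i 1) (hπw : π w = 0)
    (H : ∀ g : EuclideanSpace ℝ (Fin d) → ℝ, ContDiff ℝ ∞ g →
      ∫ x, α (graphMap t₀ v w g x) (fun i => fderiv ℝ (graphMap t₀ v w g) x
        (EuclideanSpace.single i 1)) = 0) :
    extDeriv α t₀ (Fin.cons w v) = 0 := by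
  let P := EuclideanSpace ℝ (Fin d)
  let e : Fin d → P := fun i => EuclideanSpace.single i 1
  let A : P → F := graphMap t₀ v w 0
  have hA : ContDiff ℝ ∞ A := contDiff_graphMap t₀ v w contDiff_const
  have hαd : Differentiable ℝ α := hα.differentiable (by simp)
  have hDα : Continuous (fderiv ℝ α) := hα.continuous_fderiv (by simp)
  -- Graph points over a point outside the ball of radius `‖π‖ * r` are off the support of `α`.
  have hfar : ∀ (g : P → ℝ) (x : P), ‖π‖ * r < ‖x‖ → r < ‖graphMap t₀ v w g x - t₀‖ := by
    intro g x hx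
    by_contra! hle
    have h1 := π.le_opNorm (graphMap t₀ v w g x - t₀)
    rw [apply_graphMap_sub hπv hπw] at h1
    exact hx.not_ge (h1.trans (by gcongr))
  have hnear : ∀ y, r < ‖y - t₀‖ → α =ᶠ[𝓝 y] fun _ => 0 := by
    intro y hy
    have : ∀ᶠ s in 𝓝 y, r < ‖s - t₀‖ :=
      (by fun_prop : Continuous fun s => ‖s - t₀‖).continuousAt.eventually_const_lt hy
    filter_upwards [this] with s hs using hsupp s hs
  have hDzero : ∀ y, r < ‖y - t₀‖ → fderiv ℝ α y = 0 := by
    intro y hy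
    rw [(hnear y hy).fderiv_eq]
    simp
  have hcomp : ∀ {f : P → ℝ}, (∀ x, ‖π‖ * r < ‖x‖ → f x = 0) → HasCompactSupport f := by
    intro f hf
    refine HasCompactSupport.intro (isCompact_closedBall (0 : P) (‖π‖ * r)) fun x hx => hf x ?_
    simpa using hx
  let D : P → ℝ := fun x => extDeriv α (A x) (Fin.cons w v)
  have hDcont : Continuous D := by
    have h1 : Continuous (extDeriv α) :=
      (ContinuousAlternatingMap.alternatizeUncurryFinCLM ℝ F ℝ).continuous.comp hDα
    exact (ContinuousAlternatingMap.apply ℝ F ℝ _).continuous.comp (h1.comp hA.continuous)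
  have hDeq : ∀ x, D x = fderiv ℝ α (A x) w v -
      ∑ i, fderiv ℝ α (A x) (v i) (Function.update v i w) := fun x =>
    alternatizeUncurryFin_cons _ w v
  -- The derivative of the integral in the direction of the graph function `g`.
  have main : ∀ g : P → ℝ, ContDiff ℝ ∞ g → HasCompactSupport g → ∫ x, g x • D x = 0 := by
    intro g hg _
    have hgd : Differentiable ℝ g := hg.differentiable (by simp)
    have hDg : Continuous (fderiv ℝ g) := hg.continuous_fderiv (by simp)
    let y : ℝ → P → F := fun ε x => A x + (ε * g x) • w
    let m : ℝ → P → Fin d → F := fun ε x i => v i + (ε * fderiv ℝ g x (e i)) • w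
    let h : ℝ → P → ℝ := fun ε x => α (y ε x) (m ε x)
    let h' : ℝ → P → ℝ := fun ε x => fderiv ℝ α (y ε x) (g x • w) (m ε x) +
      ∑ i, α (y ε x) (Function.update (m ε x) i (fderiv ℝ g x (e i) • w))
    have hyg : ∀ ε, y ε = graphMap t₀ v w (fun x => ε * g x) := fun ε => by
      ext1 x; simp [y, A, graphMap]
    have hycont : Continuous fun q : ℝ × P => y q.1 q.2 := by
      have := hA.continuous; have := hg.continuous
      fun_prop
    have hmcont : Continuous fun q : ℝ × P => m q.1 q.2 := by
      refine continuous_pi fun i => ?_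
      have : Continuous fun x => fderiv ℝ g x (e i) := hDg.clm_apply continuous_const
      fun_prop
    have heval : Continuous fun q : (F [⋀^Fin d]→L[ℝ] ℝ) × (Fin d → F) => q.1 q.2 :=
      continuous_eval
    have hcont : Continuous fun q : ℝ × P => h q.1 q.2 :=
      heval.comp ((hα.continuous.comp hycont).prodMk hmcont)
    have hcont' : Continuous fun q : ℝ × P => h' q.1 q.2 := by
      refine Continuous.add ?_ (continuous_finsetSum _ fun i _ => ?_)
      · exact heval.comp (((hDα.comp hycont).clm_apply
          ((hg.continuous.comp continuous_snd).smul continuous_const)).prodMk hmcont)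
      · exact heval.comp ((hα.continuous.comp hycont).prodMk (hmcont.update i
          (((hDg.comp continuous_snd).clm_apply continuous_const).smul continuous_const)))
    have hzero : ∀ ε x, ‖π‖ * r < ‖x‖ → h ε x = 0 := fun ε x hx => by
      simp only [h]
      rw [hyg, hsupp _ (hfar _ x hx)]
      rfl
    have hzero' : ∀ ε x, ‖π‖ * r < ‖x‖ → h' ε x = 0 := fun ε x hx => by
      simp only [h']
      rw [hyg, hsupp _ (hfar _ x hx), hDzero _ (hfar _ x hx)]
      simp
    have hderiv : ∀ ε x, HasDerivAt (fun s => h s x) (h' ε x) ε := by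
      intro ε x
      have h1 : HasDerivAt (fun s => y s x) (g x • w) ε := by
        simpa [y] using (((hasDerivAt_id ε).mul_const (g x)).smul_const w).const_add (A x)
      have h2 : ∀ i, HasDerivAt (fun s => m s x i) (fderiv ℝ g x (e i) • w) ε := fun i => by
        simpa [m] using (((hasDerivAt_id ε).mul_const (fderiv ℝ g x (e i))).smul_const w).const_add
          (v i)
      have h3 := (HasFDerivAt.continuousAlternatingMap_apply
        ((hαd (y ε x)).hasFDerivAt.comp ε h1.hasFDerivAt) fun i => (h2 i).hasFDerivAt).hasDerivAt
      refine h3.congr_deriv ?_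
      simp [h']
    obtain ⟨M, hM⟩ := ((isCompact_Icc (a := (-1 : ℝ)) (b := 1)).prod
      (isCompact_closedBall (0 : P) (‖π‖ * r))).exists_bound_of_continuousOn hcont'.continuousOn
    have hint := (hasDerivAt_integral_of_dominated_loc_of_deriv_le (μ := volume) (F := h)
      (F' := h') (x₀ := 0) (s := Icc (-1) 1)
      (bound := (Metric.closedBall (0 : P) (‖π‖ * r)).indicator fun _ => M)
      (Icc_mem_nhds (by norm_num) (by norm_num))
      (.of_forall fun ε => (hcont.comp (by fun_prop :
        Continuous fun x : P => (ε, x))).aestronglyMeasurable)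
      ((hcont.comp (by fun_prop :
        Continuous fun x : P => ((0 : ℝ), x))).integrable_of_hasCompactSupport (hcomp (hzero 0)))
      (hcont'.comp (by fun_prop : Continuous fun x : P => ((0 : ℝ), x))).aestronglyMeasurable
      (.of_forall fun x ε hε => by
        by_cases hx : x ∈ Metric.closedBall (0 : P) (‖π‖ * r)
        · rw [indicator_of_mem hx]
          exact hM (ε, x) ⟨hε, hx⟩
        · rw [indicator_of_notMem hx, hzero' ε x (by simpa using hx), norm_zero])
      ((integrable_indicator_iff Metric.isClosed_closedBall.measurableSet).2
        (integrableOn_const (isCompact_closedBall _ _).measure_lt_top.ne))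
      (.of_forall fun x ε _ => hderiv ε x)).2
    have hI : (fun ε => ∫ x, h ε x) = fun _ => 0 := by
      ext1 ε
      have hεg : ContDiff ℝ ∞ fun x => ε * g x := contDiff_const.mul hg
      rw [← H _ hεg]
      refine integral_congr_ae (.of_forall fun x => ?_)
      simp only [h]
      rw [hyg]
      congr 1
      ext1 i
      rw [fderiv_graphMap_single _ _ _ (hεg.differentiable (by simp)),
        fderiv_const_mul (hgd x)]
      simp [m, e]
    rw [hI] at hint
    have h0 : ∫ x, h' 0 x = 0 := hint.unique (hasDerivAt_const _ _)
    -- Integration by parts removes the derivatives of `g`.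
    let b : Fin d → P → ℝ := fun i x => α (A x) (Function.update v i w)
    have hb : ∀ i, ContDiff ℝ ∞ (b i) := fun i =>
      (ContinuousAlternatingMap.apply ℝ F ℝ (Function.update v i w)).contDiff.comp (hα.comp hA)
    have hbsupp : ∀ i, HasCompactSupport (b i) := fun i => hcomp fun x hx => by
      simp only [b]
      rw [hsupp _ (hfar _ x hx)]
      rfl
    have hbd : ∀ i x, fderiv ℝ (b i) x (e i) =
        fderiv ℝ α (A x) (v i) (Function.update v i w) := fun i x => by
      have h1 : fderiv ℝ A x (e i) = v i := by
        have := fderiv_graphMap_single t₀ v w (g := 0) (differentiable_const _) x i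
        simpa using this
      have h2 := ((ContinuousAlternatingMap.apply ℝ F ℝ (Function.update v i w)).hasFDerivAt.comp x
        ((hαd (A x)).hasFDerivAt.comp x (hA.differentiable (by simp) x).hasFDerivAt)).fderiv
      rw [show b i = _ from rfl]
      refine (DFunLike.congr_fun h2 (e i)).trans ?_
      simp [h1]
    have hbD : ∀ i, Continuous fun x => fderiv ℝ (b i) x (e i) := fun i =>
      ((hb i).continuous_fderiv (by simp)).clm_apply continuous_const
    have hbDsupp : ∀ i, HasCompactSupport fun x => fderiv ℝ (b i) x (e i) := fun i =>
      (hbsupp i).fderiv_apply (𝕜 := ℝ) (e i)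
    have hgD : ∀ i, Continuous fun x => fderiv ℝ g x (e i) := fun i =>
      hDg.clm_apply continuous_const
    have i1 : ∀ i, Integrable fun x => fderiv ℝ g x (e i) * b i x := fun i =>
      ((hgD i).mul (hb i).continuous).integrable_of_hasCompactSupport (hbsupp i).mul_left
    have i2 : ∀ i, Integrable fun x => g x * fderiv ℝ (b i) x (e i) := fun i =>
      (hg.continuous.mul (hbD i)).integrable_of_hasCompactSupport (hbDsupp i).mul_left
    have i3 : ∀ i, Integrable fun x => g x * b i x := fun i =>
      (hg.continuous.mul (hb i).continuous).integrable_of_hasCompactSupport (hbsupp i).mul_left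
    have hparts : ∀ i, ∫ x, fderiv ℝ g x (e i) * b i x = - ∫ x, g x * fderiv ℝ (b i) x (e i) :=
      fun i => by
        rw [integral_mul_fderiv_eq_neg_fderiv_mul_of_integrable (i1 i) (i2 i) (i3 i)
          (fun x _ => hgd x) (fun x _ => (hb i).differentiable (by simp) x), neg_neg]
    have hw : Continuous fun x => fderiv ℝ α (A x) w v :=
      (ContinuousAlternatingMap.apply ℝ F ℝ v).continuous.comp
        ((hDα.comp hA.continuous).clm_apply continuous_const)
    have i4 : Integrable fun x => g x * fderiv ℝ α (A x) w v :=
      (hg.continuous.mul hw).integrable_of_hasCompactSupport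
        (HasCompactSupport.mul_left (hcomp fun x hx => by
          rw [hDzero _ (hfar _ x hx)]; rfl))
    have e1 : h' 0 = fun x => g x * fderiv ℝ α (A x) w v + ∑ i, fderiv ℝ g x (e i) * b i x := by
      ext1 x
      have : m 0 x = v := by ext1 i; simp [m]
      simp [h', this, y, b]
    have e2 : (fun x => g x • D x) = fun x => g x * fderiv ℝ α (A x) w v -
        ∑ i, g x * fderiv ℝ (b i) x (e i) := by
      ext1 x
      simp [hDeq, hbd, mul_sub, Finset.mul_sum]
    rw [e1, integral_add i4 (integrable_finsetSum _ fun i _ => i1 i),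
      integral_finsetSum _ fun i _ => i1 i] at h0
    rw [e2, integral_sub i4 (integrable_finsetSum _ fun i _ => i2 i),
      integral_finsetSum _ fun i _ => i2 i, ← h0]
    simp [hparts, sub_eq_add_neg]
  have hae := ae_eq_zero_of_integral_contDiff_smul_eq_zero hDcont.locallyIntegrable main
  have hD0 : D = fun _ => 0 := (hDcont.ae_eq_iff_eq volume continuous_const).1 hae
  have := congrFun hD0 0
  simpa [D, A, graphMap] using this

end

/-! ### Graphs as test surfaces -/

section

variable {N d : ℕ}

/-- The graph of a smooth function over the open ball of radius `R` in an affine `d`-plane, as a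
parametrized patch. -/
def graphPatch (t₀ : MultiTime N) {v : Fin d → MultiTime N} {w : MultiTime N}
    {π : MultiTime N →L[ℝ] EuclideanSpace ℝ (Fin d)}
    (hπv : ∀ i, π (v i) = EuclideanSpace.single i 1) (hπw : π w = 0)
    {g : EuclideanSpace ℝ (Fin d) → ℝ} (hg : ContDiff ℝ ∞ g) (R : ℝ) : Patch N d where
  source := Metric.ball 0 R
  toFun := graphMap t₀ v w g
  isOpen_source := Metric.isOpen_ball
  contDiffOn := (contDiff_graphMap t₀ v w hg).contDiffOn
  immersion := fun x _ => by
    have h1 : HasFDerivAt (fun x => π (graphMap t₀ v w g x - t₀))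
        (π.comp (fderiv ℝ (graphMap t₀ v w g) x)) x :=
      π.hasFDerivAt.comp x
        (((contDiff_graphMap t₀ v w hg).differentiable (by simp) x).hasFDerivAt.sub_const t₀)
    simp_rw [apply_graphMap_sub hπv hπw] at h1
    have h2 := h1.unique (hasFDerivAt_id x)
    exact Function.LeftInverse.injective (g := π) fun z => DFunLike.congr_fun h2 z
  embedding := by
    have h : Topology.IsEmbedding (graphMap t₀ v w g) :=
      Function.LeftInverse.isEmbedding (f := fun y => π (y - t₀))
        (fun x => apply_graphMap_sub hπv hπw g x) (by fun_prop)
        (contDiff_graphMap t₀ v w hg).continuous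
    exact h.comp Topology.IsEmbedding.subtypeVal

/-- The graph of a smooth function over a closed ball in an affine `d`-plane, as a compact surface
with boundary. -/
def graphSurface (t₀ : MultiTime N) {v : Fin d → MultiTime N} {w : MultiTime N}
    {π : MultiTime N →L[ℝ] EuclideanSpace ℝ (Fin d)}
    (hπv : ∀ i, π (v i) = EuclideanSpace.single i 1) (hπw : π w = 0)
    {g : EuclideanSpace ℝ (Fin d) → ℝ} (hg : ContDiff ℝ ∞ g) (R : ℝ) : OrientedSurface N d :=
  have hinj : Function.Injective (graphMap t₀ v w g) :=
    Function.LeftInverse.injective (g := fun y => π (y - t₀))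
      fun x => apply_graphMap_sub hπv hπw g x
  have hdiff : graphMap t₀ v w g '' Metric.closedBall 0 R \ graphMap t₀ v w g '' Metric.sphere 0 R =
      graphMap t₀ v w g '' Metric.ball 0 R := by
    rw [← image_sdiff hinj, Metric.closedBall_sdiff_sphere]
  { carrier := graphMap t₀ v w g '' Metric.closedBall 0 R
    boundary := graphMap t₀ v w g '' Metric.sphere 0 R
    atlas := {graphPatch t₀ hπv hπw hg R}
    isCompact_carrier :=
      (isCompact_closedBall _ _).image (contDiff_graphMap t₀ v w hg).continuous
    isClosed_boundary :=
      ((isCompact_sphere _ _).image (contDiff_graphMap t₀ v w hg).continuous).isClosed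
    boundary_subset := image_mono Metric.sphere_subset_closedBall
    image_isOpen := by
      rintro _ rfl
      refine ⟨univ, isOpen_univ, ?_⟩
      rw [hdiff, univ_inter]
      rfl
    cover := by
      intro y hy
      rw [hdiff] at hy
      exact ⟨_, rfl, hy⟩
    oriented := by
      rintro _ rfl _ rfl x _ y _ hxy
      obtain rfl : x = y := hinj hxy
      exact ⟨ContinuousLinearMap.id ℝ _, by
        rw [ContinuousLinearMap.det, ContinuousLinearMap.coe_id, LinearMap.det_id]
        exact one_pos, (ContinuousLinearMap.comp_id _).symm⟩ }

/-- The coordinates along the last `d` of `d + 1` linearly independent vectors, extended to a linear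
map on the whole space. -/
lemma exists_coordinates_of_linearIndependent {w : MultiTime N} {v : Fin d → MultiTime N}
    (h : LinearIndependent ℝ (Fin.cons w v : Fin (d + 1) → MultiTime N)) :
    ∃ π : MultiTime N →L[ℝ] EuclideanSpace ℝ (Fin d),
      (∀ i, π (v i) = EuclideanSpace.single i 1) ∧ π w = 0 := by
  obtain ⟨c, hc⟩ := LinearMap.exists_leftInverse_of_injective _ (LinearMap.ker_eq_bot.2 h)
  let f : MultiTime N →ₗ[ℝ] EuclideanSpace ℝ (Fin d) :=
    (Finsupp.linearCombination ℝ (Fin.cons 0 fun i => EuclideanSpace.single i 1)).comp c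
  have hf : ∀ j, f ((Fin.cons w v : Fin (d + 1) → MultiTime N) j) =
      (Fin.cons 0 fun i => EuclideanSpace.single i 1 :
        Fin (d + 1) → EuclideanSpace ℝ (Fin d)) j := fun j => by
    have hj := LinearMap.congr_fun hc (Finsupp.single j 1)
    simp only [LinearMap.comp_apply, Finsupp.linearCombination_single, one_smul,
      LinearMap.id_apply] at hj
    simp only [f, LinearMap.comp_apply, hj, Finsupp.linearCombination_single, one_smul]
  refine ⟨LinearMap.toContinuousLinearMap f, fun i => ?_, ?_⟩
  · simpa using hf i.succ
  · simpa using hf 0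

/-- At the jet of a critical point, the vertical derivative of `dL` vanishes. Variations supported
in a ball and graphs of functions over affine planes suffice as tests. -/
theorem verticalD_horizontalD_eq_zero {n : ℕ} {L : HorizontalForm N n d} (hL : ContDiff ℝ ∞ L)
    {u : SmoothField N} (hu : IsCritical L u) (t₀ : MultiTime N) :
    verticalD (horizontalD L) (t₀, jet (n + 1) u.toFun t₀) = 0 := by
  ext a z
  obtain ⟨V, hV, hVsupp, rfl⟩ := exists_contDiff_jet_eq (n + 1) t₀ a
  rw [← extDeriv_firstVariation hL u hV]
  -- On linearly dependent vectors every alternating form vanishes.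
  by_cases hli : LinearIndependent ℝ z
  swap
  · exact (extDeriv (firstVariation L u V) t₀).toAlternatingMap.map_linearDependent z hli
  obtain ⟨w, v, rfl⟩ : ∃ w v, z = Fin.cons w v := ⟨z 0, Fin.tail z, (Fin.cons_self_tail z).symm⟩
  obtain ⟨π, hπv, hπw⟩ := exists_coordinates_of_linearIndependent hli
  have hα : ∀ y, 1 < ‖y - t₀‖ → firstVariation L u V y = 0 := fun y hy => by
    rw [firstVariation, jet_eq_zero n (hVsupp y hy), map_zero]
  refine extDeriv_eq_zero_of_integral_graphMap_eq_zero (contDiff_firstVariation hL u hV) hα hπv hπw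
    fun g hg => ?_
  have hfar : ∀ x, ‖π‖ < ‖x‖ → 1 < ‖graphMap t₀ v w g x - t₀‖ := by
    intro x hx
    by_contra! hle
    have h1 := π.le_opNorm (graphMap t₀ v w g x - t₀)
    rw [apply_graphMap_sub hπv hπw] at h1
    exact hx.not_ge (h1.trans (mul_le_of_le_one_right (norm_nonneg _) hle))
  have hR : ‖π‖ < ‖π‖ + 1 := lt_add_one _
  refine hu (graphSurface t₀ hπv hπw hg (‖π‖ + 1)) V hV ?_ _ ⟨1, fun _ =>
    graphPatch t₀ hπv hπw hg (‖π‖ + 1), fun _ _ => 1, fun _ => rfl, fun _ => contDiff_const,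
    fun _ => ⟨Metric.closedBall 0 ‖π‖, Metric.closedBall_subset_ball hR, isCompact_closedBall _ _,
      ?_⟩, by simp, ?_⟩
  · rintro _ ⟨x, hx, rfl⟩
    refine hVsupp _ (hfar x ?_)
    rw [mem_sphere_zero_iff_norm.1 hx]
    exact hR
  · rintro _ ⟨x, hx, rfl⟩ hnot
    rw [hα _ (hfar x ?_), smul_zero]
    by_contra! hle
    exact hnot ⟨x, by simpa using hle, rfl⟩
  · rw [Fin.sum_univ_one, Patch.integral]
    simp only [one_smul]
    refine (setIntegral_eq_integral_of_forall_compl_eq_zero fun x hx => ?_).symm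
    have hx' : ‖π‖ + 1 ≤ ‖x‖ := by
      simpa [graphPatch] using hx
    change firstVariation L u V (graphMap t₀ v w g x) _ = 0
    rw [hα _ (hfar x (hR.trans_le hx'))]
    rfl

end

/-! ### Constancy on connected sets of critical points -/

section

variable {N : ℕ}

/-- A smooth real-valued function is constant on preconnected sets of critical points: by Sard's
theorem the image of such a set is a null interval. -/
lemma eq_of_isPreconnected_of_fderiv_eq_zero {E : Type*} [NormedAddCommGroup E] [NormedSpace ℝ E]
    [FiniteDimensional ℝ E] {f : E → ℝ} (hf : ContDiff ℝ ∞ f) {K : Set E} (hK : IsPreconnected K)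
    (hcrit : ∀ x ∈ K, fderiv ℝ f x = 0) {x y : E} (hx : x ∈ K) (hy : y ∈ K) : f x = f y := by
  have hnull : volume (f '' K) = 0 :=
    measure_mono_null (image_mono (show K ⊆ {x ∈ univ | fderiv ℝ f x = 0} from
      fun x hx => ⟨mem_univ x, hcrit x hx⟩))
      (volume_image_critical_eq_zero _ E rfl f univ isOpen_univ
        (hf.of_le (mod_cast le_top)).contDiffOn)
  have hord := (hK.image f hf.continuous.continuousOn).ordConnected
  by_contra hne
  wlog hlt : f x < f y generalizing x y
  · exact this hy hx (Ne.symm hne) (lt_of_le_of_ne (not_lt.1 hlt) (Ne.symm hne))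
  have hsub : Icc (f x) (f y) ⊆ f '' K := hord.out ⟨x, hx, rfl⟩ ⟨y, hy, rfl⟩
  have := measure_mono_null hsub hnull
  rw [Real.volume_Icc, ENNReal.ofReal_eq_zero] at this
  linarith

lemma continuous_jet_toFun (n : ℕ) (t : MultiTime N) :
    Continuous fun u : SmoothField N => jet n u.toFun t := by
  refine continuous_pi fun I => ?_
  have h1 : Continuous fun u : SmoothField N => u.derivMap I.1 :=
    (continuous_apply I.1).comp
      (continuous_induced_dom (f := fun (u : SmoothField N) (I : Fin N → ℕ) => u.derivMap I))
  exact (ContinuousEvalConst.continuous_eval_const t).comp h1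

/-- The values of a horizontal form at `t` on the fields of a preconnected set `C` are values on the
preconnected set of the jets at `t`, at whose points the form is vertically critical. -/
lemma eval_eq_eval_of_isPreconnected {n q : ℕ} {η : HorizontalForm N n q} (hη : ContDiff ℝ ∞ η)
    {C : Set (SmoothField N)} (hC : IsPreconnected C)
    (hcrit : ∀ u ∈ C, ∀ t, verticalD η (t, jet n u.toFun t) = 0) {u₁ u₂ : SmoothField N}
    (h₁ : u₁ ∈ C) (h₂ : u₂ ∈ C) : η.eval u₁ = η.eval u₂ := by
  ext t z
  let f : Jet N n → ℝ := fun p => η (t, p) z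
  have hηt : ContDiff ℝ ∞ fun p : Jet N n => η (t, p) :=
    hη.comp (contDiff_const.prodMk contDiff_id)
  refine eq_of_isPreconnected_of_fderiv_eq_zero (f := f)
    ((ContinuousAlternatingMap.apply ℝ (MultiTime N) ℝ z).contDiff.comp hηt)
    (hC.image _ (continuous_jet_toFun n t).continuousOn) ?_ (mem_image_of_mem _ h₁)
    (mem_image_of_mem _ h₂)
  rintro _ ⟨u, hu, rfl⟩
  have h := (ContinuousAlternatingMap.apply ℝ (MultiTime N) ℝ z).hasFDerivAt.comp _
    (hηt.differentiable (by simp) (jet n u.toFun t)).hasFDerivAt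
  have h0 : fderiv ℝ (fun p : Jet N n => η (t, p)) (jet n u.toFun t) = 0 := hcrit u hu t
  rw [h0, ContinuousLinearMap.comp_zero] at h
  exact h.fderiv

/-- The derivative of a form that does not depend on `t` is invariant under translations of `t`, so
that its horizontal derivative does not depend on `t` either. -/
lemma HorizontalForm.Autonomous.horizontalD {n q : ℕ} {η : HorizontalForm N n q}
    (ha : η.Autonomous) : (horizontalD η).Autonomous := by
  intro s t p
  have h : ∀ r : MultiTime N, ∀ x : MultiTime N × Jet N n,
      fderiv ℝ η (x + (r, 0)) = fderiv ℝ η x := by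
    intro r x
    rw [← fderiv_comp_add_right]
    congr 1
    ext1 y
    have hy : y + (r, 0) = (y.1 + r, y.2) := by ext <;> simp
    rw [hy]
    exact ha _ _ _
  simp only [PluriLagrangian.horizontalD]
  rw [← h (t - s) (s, _)]
  simp

/-- An autonomous form is constant along a field at whose jets its vertical derivative vanishes,
since then all its partial derivatives vanish there. -/
lemma eval_eq_of_autonomous {n q : ℕ} {η : HorizontalForm N n q} (hη : Differentiable ℝ η)
    (ha : η.Autonomous) {u : SmoothField N} (hu : ∀ t, verticalD η (t, jet n u.toFun t) = 0)
    (s t : MultiTime N) : η.eval u s = η.eval u t := by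
  have e : η.eval u = fun r => η (s, jet n u.toFun r) := by
    ext1 r
    exact ha _ _ _
  have hd : ∀ r, HasFDerivAt (η.eval u) (0 : MultiTime N →L[ℝ] _) r := by
    intro r
    have h0 : fderiv ℝ (fun p : Jet N n => η (s, p)) (jet n u.toFun r) = 0 := by
      rw [← hu r, verticalD]
      congr 1
      ext1 p
      exact ha _ _ _
    have hs : DifferentiableAt ℝ (fun p : Jet N n => η (s, p)) (jet n u.toFun r) :=
      (hη _).comp _ (hasFDerivAt_prodMk_right s _).differentiableAt
    have h := hs.hasFDerivAt.comp r (hasFDerivAt_jet n u.smooth r)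
    rw [h0, ContinuousLinearMap.zero_comp] at h
    rw [e]
    exact h
  exact is_const_of_fderiv_eq_zero (𝕜 := ℝ) (fun r => (hd r).differentiableAt)
    (fun r => (hd r).fderiv) s t

end

end PluriLagrangian

end

theorem mainTheorem7 (N n d : ℕ) (L : PluriLagrangian.HorizontalForm N n d)
    (hL : ContDiff ℝ ∞ L) :
    (∀ u : PluriLagrangian.SmoothField N, PluriLagrangian.IsCritical L u →
      ∀ t : PluriLagrangian.MultiTime N,
        PluriLagrangian.verticalD (PluriLagrangian.horizontalD L)
          (t, PluriLagrangian.jet (n + 1) u.toFun t) = 0) ∧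
    (∀ C : Set (PluriLagrangian.SmoothField N),
      (∀ u ∈ C, PluriLagrangian.IsCritical L u) → IsPreconnected C →
      ∃ η : PluriLagrangian.MultiTime N →
          PluriLagrangian.MultiTime N [⋀^Fin (d + 1)]→L[ℝ] ℝ,
        (∀ u ∈ C, (PluriLagrangian.horizontalD L).eval u = η) ∧
        (L.Autonomous → ∀ s t : PluriLagrangian.MultiTime N, η s = η t)) := by
  have hdL := PluriLagrangian.contDiff_horizontalD hL
  refine ⟨fun u hu t => PluriLagrangian.verticalD_horizontalD_eq_zero hL hu t,
    fun C hC hconn => ?_⟩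
  rcases C.eq_empty_or_nonempty with rfl | ⟨u₀, hu₀⟩
  · exact ⟨0, by simp, fun _ _ _ => rfl⟩
  have hcrit : ∀ u ∈ C, ∀ t, _ := fun u hu t =>
    PluriLagrangian.verticalD_horizontalD_eq_zero hL (hC u hu) t
  refine ⟨(PluriLagrangian.horizontalD L).eval u₀, fun u hu =>
    PluriLagrangian.eval_eq_eval_of_isPreconnected hdL hconn hcrit hu hu₀, fun ha s t => ?_⟩
  exact PluriLagrangian.eval_eq_of_autonomous (hdL.differentiable (by simp))
    ha.horizontalD (hcrit u₀ hu₀) s t
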